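/- Let $\mathfrak g$ be a finite-dimensional complex simple Lie algebra with Killing form $B$, Cartan subalgebra $\mathfrak t$, root system $\Delta\subset\mathfrak t^*$ and root spaces $\mathfrak g_\alpha$. Fix a system of simple roots $\Psi=\{\alpha_1,\dots,\alpha_n\}$ and a subset $\Psi'\subset\Psi$. For $k\in\mathbb Z$ let $\Delta_k$ be the set of roots $\alpha=\sum_q m_q\alpha_q$ with $\sum_{\alpha_q\in\Psi'}m_q=k$, and put $\mathfrak g_0=\mathfrak t\oplus\bigoplus_{\alpha\in\Delta_0}\mathfrak g_\alpha$ and $\mathfrak g_k=\bigoplus_{\alpha\in\Delta_k}\mathfrak g_\alpha$ for $k\neq0$, so that $\mathfrak g=\bigoplus_{k=-m}^{m}\mathfrak g_k$ is a gradation, where $m$ is the largest $k$ with $\mathfrak g_k\ne 0$. Let $k>0$ be such that $\mathfrak g_k$ is abelian (for example, any $k>m/2$). Call two roots strongly orthogonal if neither their sum nor their difference is a root or zero. Suppose that $\Pi=\{\beta_1,\dots,\beta_\ell\}\subset\Delta_k$ is a set of pairwise strongly orthogonal roots that is maximal (for inclusion) among all sets of pairwise strongly orthogonal roots in $\Delta_k$,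 and that every $\beta_j$ is a long root of $\Delta$, i.e. of maximal length with respect to the form induced by $B$. For each $j$ let $e_j\in\mathfrak g_{\beta_j}$ be a normalized root vector: $[e_j,e_{-j}]=H_{\beta_j}$ for some $e_{-j}\in\mathfrak g_{-\beta_j}$, where $H_{\beta_j}\in\mathfrak t$ is the element dual to $\beta_j$ with respect to $B$. Let $G_0\subset GL(\mathfrak g)$ be the group generated by the elements $\exp(\operatorname{ad}x)$, $x\in\mathfrak g_0$. Then for every $\xi\in\mathfrak g_k$ there are $g\in G_0$ and $c_1,\dots,c_\ell\in\{0,1\}$ with $g\cdot\xi=\sum_{j=1}^{\ell}c_je_j$. -/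

import Mathlib

open LieAlgebra LieAlgebra.IsKilling

noncomputable section

namespace GradedSimple

/-- `Ad (exp x) = exp (ad x)` as an invertible linear endomorphism of the Lie algebra; the
exponential is the matrix exponential, computed in some basis (the choice does not matter, see
`toMatrixAlgEquiv_expAd`). -/
def expAd {L : Type*} [LieRing L] [LieAlgebra ℂ L] [FiniteDimensional ℂ L] (x : L) :
    (Module.End ℂ L)ˣ :=
  ((Matrix.isUnit_exp (LinearMap.toMatrixAlgEquiv (Module.finBasis ℂ L) (ad ℂ L x))).map
    (LinearMap.toMatrixAlgEquiv (Module.finBasis ℂ L)).symm).unit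

/-- The endomorphism `exp (ad x)` can be computed in any basis. -/
theorem toMatrixAlgEquiv_expAd {L : Type*} [LieRing L] [LieAlgebra ℂ L] [FiniteDimensional ℂ L]
    {ι : Type*} [Fintype ι] [DecidableEq ι] (c : Module.Basis ι ℂ L) (x : L) :
    LinearMap.toMatrixAlgEquiv c (expAd x : Module.End ℂ L) =
      NormedSpace.exp (LinearMap.toMatrixAlgEquiv c (ad ℂ L x)) := by
  have hf : Continuous ((LinearMap.toMatrixAlgEquiv (Module.finBasis ℂ L)).symm.trans
      (LinearMap.toMatrixAlgEquiv c)) :=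
    ((LinearMap.toMatrixAlgEquiv (Module.finBasis ℂ L)).symm.trans
      (LinearMap.toMatrixAlgEquiv c)).toLinearMap.continuous_of_finiteDimensional
  let _ := Matrix.linftyOpNormedRing (n := Fin (Module.finrank ℂ L)) (α := ℂ)
  let _ := Matrix.linftyOpNormedAlgebra (n := Fin (Module.finrank ℂ L)) (R := ℂ) (α := ℂ)
  let _ := Matrix.linftyOpNormedRing (n := ι) (α := ℂ)
  let _ := Matrix.linftyOpNormedAlgebra (n := ι) (R := ℂ) (α := ℂ)
  let _ := NormedAlgebra.restrictScalars ℚ ℂ (Matrix (Fin (Module.finrank ℂ L)) (Fin (Module.finrank ℂ L)) ℂ)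
  let _ := NormedAlgebra.restrictScalars ℚ ℂ (Matrix ι ι ℂ)
  have h := NormedSpace.map_exp ((LinearMap.toMatrixAlgEquiv (Module.finBasis ℂ L)).symm.trans
      (LinearMap.toMatrixAlgEquiv c)) hf
    (LinearMap.toMatrixAlgEquiv (Module.finBasis ℂ L) (ad ℂ L x))
  simp only [AlgEquiv.trans_apply, AlgEquiv.symm_apply_apply] at h
  exact h

variable {L : Type*} [LieRing L] [LieAlgebra ℂ L] [FiniteDimensional ℂ L] [IsSimple ℂ L]
  {H : LieSubalgebra ℂ L} [H.IsCartanSubalgebra]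

/-- `Δ_k` for the gradation associated to the set `D` of distinguished simple roots of the base
`b`: the roots `α = ∑ m_q α_q` (sum over the simple roots) with `∑_{α_q ∈ D} m_q = k`. -/
def rootsOfDegree (b : (rootSystem H).Base) (D : Finset H.root) (k : ℤ) : Set H.root :=
  {α | ∃ m : H.root → ℤ,
    (rootSystem H).root α = ∑ q ∈ b.support, m q • (rootSystem H).root q ∧
    ∑ q ∈ D, m q = k}

/-- `𝔤_k`: the sum of the root spaces of the roots in `Δ_k`, together with the Cartan
subalgebra when `k = 0`. -/
def gradedPiece (b : (rootSystem H).Base) (D : Finset H.root) (k : ℤ) : Submodule ℂ L :=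
  (if k = 0 then H.toSubmodule else ⊥) ⊔
    ⨆ α ∈ rootsOfDegree b D k, (rootSpace H α.1).toSubmodule

/-- `H_φ`, the element of the Cartan subalgebra that is dual to the root `φ` with respect to the
Killing form. -/
def dualElement (φ : H.root) : H :=
  (cartanEquivDual H).symm ((rootSystem H).root φ)

/-- A root is long if its squared length `B(H_φ, H_φ)` is maximal among all roots of the Lie
algebra. These numbers are positive rationals, so comparing real parts compares them. -/
def IsLong (φ : H.root) : Prop :=
  ∀ ψ : H.root,
    (killingForm ℂ L (dualElement ψ) (dualElement ψ)).re ≤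
      (killingForm ℂ L (dualElement φ) (dualElement φ)).re

/-- Two roots are strongly orthogonal if neither their sum nor their difference is a root or
zero. -/
def StronglyOrthogonal (α β : H.root) : Prop :=
  ((rootSystem H).root α + (rootSystem H).root β ≠ 0 ∧
    (rootSystem H).root α + (rootSystem H).root β ∉ Set.range (rootSystem H).root) ∧
  ((rootSystem H).root α - (rootSystem H).root β ≠ 0 ∧
    (rootSystem H).root α - (rootSystem H).root β ∉ Set.range (rootSystem H).root)

/-- `S` is a set of pairwise strongly orthogonal roots contained in `Δ`, and no strictly larger
set of roots has this property. -/
def IsMaximalStronglyOrthogonal (Δ : Set H.root) (S : Finset H.root) : Prop :=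
  Maximal (fun T : Finset H.root =>
    (T : Set H.root) ⊆ Δ ∧ (T : Set H.root).Pairwise StronglyOrthogonal) S

/-- `x` is a normalized root vector for the root `φ`: it lies in the root space of `φ` and
`⁅x, y⁆ = H_φ` for some `y` in the root space of `-φ`. -/
def IsNormalizedRootVector (φ : H.root) (x : L) : Prop :=
  x ∈ rootSpace H φ.1 ∧
    ∃ y ∈ rootSpace H (-φ.1), ⁅x, y⁆ = (dualElement φ : L)

/-- The group generated by `exp 𝔤_0`, acting on the Lie algebra by the adjoint action. -/
def expGroup (b : (rootSystem H).Base) (D : Finset H.root) : Subgroup (Module.End ℂ L)ˣ :=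
  Subgroup.closure (expAd '' (gradedPiece b D 0 : Set L))

end GradedSimple

end

/-! The argument is Gaussian elimination along the strongly orthogonal roots. Two facts restrict how
a root `γ` in `Δ_k` pairs with the coroot of some `β` in `S`. Since `𝔤_k` is abelian, a vector of
`𝔤_γ` is primitive for the `sl₂` of `β`, so the pairing is a natural number (`exists_nat_pairing`).
Since `β` is long, it is at most 1 unless `γ = β` (`IsLong.pairing_mem`). Hence `𝔤_k` splits into
`𝔤_β`, a part with pairing 1 and a part with pairing 0.

If `ξ ≠ 0` has a component at `γ`, maximality yields `β` in `S` not orthogonal to `γ`, because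
orthogonality to a long root is already strong orthogonality (`IsLong.stronglyOrthogonal`). An
exponential of an element of `𝔤_{β-γ}` creates a component at `β` if needed
(`exists_expGroup_killingForm_ne_zero`). A second exponential uses that component as pivot to remove
the part with pairing 1 (`exists_expGroup_apply_eq_add`). What remains besides the pivot is
orthogonal to `β`.

These exponentials fix the root spaces of the roots already treated, so induction reduces `ξ` to a
combination of the `e β` (`exists_expGroup_apply_eq_sum`). The torus then rescales the nonzero
coefficients to 1, by orthogonality of `S` (`exists_expGroup_normalize`). -/

namespace GradedSimple

/-! ### Evaluating `exp (ad x)` on eigenvectors and on vectors killed by `(ad x)³`. -/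

section Exponential

variable {L : Type*} [LieRing L] [LieAlgebra ℂ L] [FiniteDimensional ℂ L]

/-- The exponential series of `ad x` converges to `expAd x` in every scalar matrix coefficient. -/
theorem hasSum_expAd (x y : L) (f : L →ₗ[ℂ] ℂ) :
    HasSum (fun n : ℕ => ((n.factorial : ℂ)⁻¹) * f (((ad ℂ L x) ^ n) y))
      (f ((expAd x : Module.End ℂ L) y)) := by
  set c := Module.finBasis ℂ L
  -- The norm is auxiliary: it only gives access to the exponential series, and the conclusion is
  -- about scalars.
  let _ := Matrix.linftyOpNormedRing (n := Fin (Module.finrank ℂ L)) (α := ℂ)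
  let _ := Matrix.linftyOpNormedAlgebra (n := Fin (Module.finrank ℂ L)) (R := ℂ) (α := ℂ)
  let φ : Matrix (Fin (Module.finrank ℂ L)) (Fin (Module.finrank ℂ L)) ℂ →ₗ[ℂ] ℂ :=
    f ∘ₗ LinearMap.applyₗ y ∘ₗ (LinearMap.toMatrixAlgEquiv c).symm.toLinearMap
  have hφ : Continuous φ := φ.continuous_of_finiteDimensional
  have h := (NormedSpace.exp_series_hasSum_exp' (𝕂 := ℂ)
    (LinearMap.toMatrixAlgEquiv c (ad ℂ L x))).map φ hφ
  have h' : φ (NormedSpace.exp (LinearMap.toMatrixAlgEquiv c (ad ℂ L x))) =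
      φ (LinearMap.toMatrixAlgEquiv c (expAd x : Module.End ℂ L)) := by
    rw [toMatrixAlgEquiv_expAd]
  convert h using 1
  · ext n
    simp only [Function.comp_apply, map_smul, ← map_pow, smul_eq_mul]
    simp [φ]
  · exact Eq.trans (by simp [φ]) h'.symm

theorem eq_of_forall_dual {y z : L} (h : ∀ f : L →ₗ[ℂ] ℂ, f y = f z) : y = z := by
  rw [← sub_eq_zero, ← Module.forall_dual_apply_eq_zero_iff ℂ]
  intro f
  rw [map_sub, h f, sub_self]

theorem expAd_apply_of_lie_eq_smul {x y : L} {a : ℂ} (h : ⁅x, y⁆ = a • y) :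
    (expAd x : Module.End ℂ L) y = Complex.exp a • y := by
  refine eq_of_forall_dual fun f => (hasSum_expAd x y f).unique ?_
  have hp (n : ℕ) : ((ad ℂ L x) ^ n) y = a ^ n • y := by
    induction n with
    | zero => simp
    | succ n ih => rw [pow_succ', Module.End.mul_apply, ih, map_smul, ad_apply, h, smul_smul, pow_succ]
  have := (NormedSpace.exp_series_hasSum_exp' (𝕂 := ℂ) a).mul_right (f y)
  rw [← Complex.exp_eq_exp_ℂ] at this
  simpa [hp, mul_assoc] using this

theorem expAd_apply_of_lie_eq_zero {x y : L} (h : ⁅x, y⁆ = 0) :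
    (expAd x : Module.End ℂ L) y = y := by
  simpa using expAd_apply_of_lie_eq_smul (a := 0) (by simpa using h)

theorem expAd_apply_of_lie_lie_lie_eq_zero {x y : L} (h : ⁅x, ⁅x, ⁅x, y⁆⁆⁆ = 0) :
    (expAd x : Module.End ℂ L) y = y + ⁅x, y⁆ + (2⁻¹ : ℂ) • ⁅x, ⁅x, y⁆⁆ := by
  refine eq_of_forall_dual fun f => (hasSum_expAd x y f).unique ?_
  have h3 : ((ad ℂ L x) ^ 3) y = 0 := by simpa [pow_succ] using h
  have := hasSum_sum_of_ne_finset_zero (L := .unconditional ℕ) (s := Finset.range 3)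
    (f := fun n : ℕ => ((n.factorial : ℂ)⁻¹) * f (((ad ℂ L x) ^ n) y)) (by
      intro n hn
      obtain ⟨m, rfl⟩ := Nat.exists_eq_add_of_le (show 3 ≤ n by simpa using hn)
      rw [add_comm, pow_add, Module.End.mul_apply, h3]
      simp)
  simpa [Finset.sum_range_succ, pow_succ] using this

end Exponential

/-! ### Root lengths and pairings with a long root. -/

section Roots

open LieModule

variable {L : Type*} [LieRing L] [LieAlgebra ℂ L] [FiniteDimensional ℂ L] [IsSimple ℂ L]
  {H : LieSubalgebra ℂ L} [H.IsCartanSubalgebra]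

theorem killingForm_dualElement (φ : H.root) (x : H) :
    killingForm ℂ L (dualElement φ) x = φ.1 x := by
  have : cartanEquivDual H (dualElement φ) x = φ.1 x := by
    simp [dualElement]
  rw [← this]; rfl

theorem root_dualElement_comm (φ ψ : H.root) : φ.1 (dualElement ψ) = ψ.1 (dualElement φ) := by
  rw [← killingForm_dualElement, ← killingForm_dualElement, LieModule.traceForm_comm]

theorem root_dualElement_ne_zero (φ : H.root) : φ.1 (dualElement φ) ≠ 0 :=
  root_apply_cartanEquivDual_symm_ne_zero (H.isNonZero_coe_root φ)

theorem root_apply_coroot_mul (φ ψ : H.root) :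
    φ.1 (coroot ψ.1) * ψ.1 (dualElement ψ) = 2 * φ.1 (dualElement ψ) := by
  have h : coroot ψ.1 = 2 • (ψ.1 (dualElement ψ))⁻¹ • dualElement ψ := rfl
  have := root_dualElement_ne_zero ψ
  rw [h, ← Weight.toLinear_apply, map_nsmul, map_smul]
  simp only [Weight.toLinear_apply, smul_eq_mul, nsmul_eq_mul]
  field_simp
  push_cast
  ring

theorem exists_int_root_apply_coroot (φ : Weight ℂ H L) (ψ : Weight ℂ H L) :
    ∃ n : ℤ, φ (coroot ψ) = n :=
  ⟨_, apply_coroot_eq_cast ψ φ⟩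

/-- With `b = B(H_φ, H_φ)`, the trace formula gives `b = ∑ α(H_φ)²`, and `α(H_φ) = n_α b / 2` with
`n_α` an integer. Dividing by `b ≠ 0` leaves `b ∑ n_α² = 4`, which forces the real part to be
positive. -/
theorem root_dualElement_re_pos (φ : H.root) : 0 < (φ.1 (dualElement φ)).re := by
  choose n hn using fun α : H.root => exists_int_root_apply_coroot α.1 φ.1
  set b := φ.1 (dualElement φ) with hb
  have hb0 : b ≠ 0 := root_dualElement_ne_zero φ
  have h1 : b = ∑ α : H.root, α.1 (dualElement φ) * α.1 (dualElement φ) := by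
    have := congr($(restrict_killingForm_eq_sum (K := ℂ) (L := L) (H := H))
      (dualElement φ) (dualElement φ))
    rw [← Finset.sum_coe_sort] at this
    simp only [LinearMap.sum_apply, LinearMap.smulRight_apply, LinearMap.smul_apply,
      Weight.toLinear_apply, smul_eq_mul] at this
    rw [← this, hb, ← killingForm_dualElement]; rfl
  have h2 : b * ∑ α : H.root, ((n α : ℝ) ^ 2 : ℂ) = 4 := by
    have h3 (α : H.root) : α.1 (dualElement φ) = n α * b / 2 := by
      rw [← hn, hb, root_apply_coroot_mul]; ring
    have h4 : b = b * (b * ∑ α : H.root, ((n α : ℝ) ^ 2 : ℂ)) / 4 := by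
      conv_lhs => rw [h1]
      rw [Finset.mul_sum, Finset.mul_sum, Finset.sum_div]
      refine Finset.sum_congr rfl fun α _ => ?_
      rw [h3]; push_cast; ring
    apply mul_left_cancel₀ hb0
    linear_combination -4 * h4
  have h5 : b.re * ∑ α : H.root, (n α : ℝ) ^ 2 = 4 := by
    have := congr_arg Complex.re h2
    rw [show (∑ α : H.root, ((n α : ℝ) ^ 2 : ℂ)) = ((∑ α : H.root, (n α : ℝ) ^ 2 : ℝ) : ℂ) by
      push_cast; rfl, Complex.re_mul_ofReal] at this
    simpa using this
  have h6 : 0 ≤ ∑ α : H.root, (n α : ℝ) ^ 2 := Finset.sum_nonneg fun _ _ => sq_nonneg _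
  by_contra hcon
  nlinarith [mul_nonneg (neg_nonneg.2 (not_lt.1 hcon)) h6]

/-- A root different from `±β`, with `β` long, pairs with the coroot of `β` to `-1`, `0` or `1`. -/
theorem IsLong.pairing_mem {β : H.root} (hβ : IsLong β) {γ : H.root} (h : γ.1 ≠ β.1)
    (h' : γ.1 ≠ -β.1) :
    γ.1 (coroot β.1) = -1 ∨ γ.1 (coroot β.1) = 0 ∨ γ.1 (coroot β.1) = 1 := by
  have e1 := (rootSystem H).algebraMap_pairingIn ℤ γ β
  have e2 := (rootSystem H).algebraMap_pairingIn ℤ β γ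
  have hm := (rootSystem H).pairingIn_pairingIn_mem_set_of_isCrystal_of_isRed' γ β
    (by intro h0; exact h (congr_arg Subtype.val ((rootSystem H).root.injective h0)))
    (by
      intro h0; apply h'; ext x
      exact congr($h0 x))
  have hlen := hβ γ
  rw [killingForm_dualElement, killingForm_dualElement] at hlen
  have hpos := root_dualElement_re_pos β
  -- Both sides are `2 B(H_γ, H_β)`. As `β` is at least as long as `γ`, its pairing is the smaller
  -- one in absolute value, which rules out ±2 and ±3 in the finite list `hm`.
  have hc : γ.1 (coroot β.1) * β.1 (dualElement β) = β.1 (coroot γ.1) * γ.1 (dualElement γ) := by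
    rw [root_apply_coroot_mul, root_apply_coroot_mul, root_dualElement_comm]
  rw [rootSystem_pairing_apply] at e1 e2
  rw [← e1, ← e2] at hc
  rw [← e1]
  generalize (rootSystem H).pairingIn ℤ γ β = p at *
  generalize (rootSystem H).pairingIn ℤ β γ = q at *
  have hc' := congr_arg Complex.re hc
  simp only [algebraMap_int_eq, eq_intCast, Set.mem_insert_iff, Set.mem_singleton_iff,
    Prod.mk.injEq] at hc' hm ⊢
  rcases hm with hm | hm | hm | hm | hm | hm | hm | hm | hm | hm | hm <;> obtain ⟨rfl, rfl⟩ := hm <;>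
    simp at hc' ⊢ <;> linarith

end Roots

/-! ### Sums of root spaces, degrees, and the pairing inside an abelian piece. -/

section Pieces

open LieModule

variable {L : Type*} [LieRing L] [LieAlgebra ℂ L] [FiniteDimensional ℂ L]
  {H : LieSubalgebra ℂ L} [H.IsCartanSubalgebra]

theorem eq_zero_or_exists_root {χ : H → ℂ} (hχ : χ ≠ 0) {x : L} (hx : x ∈ rootSpace H χ) :
    x = 0 ∨ ∃ γ : H.root, (γ.1 : H → ℂ) = χ := by
  by_cases hbot : rootSpace H χ = ⊥
  · left; simpa [hbot] using hx
  · right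
    refine ⟨⟨⟨χ, hbot⟩, ?_⟩, rfl⟩
    simpa [Weight.IsNonZero, Weight.IsZero] using hχ

/-- The sum of the root spaces of the roots in a set. -/
noncomputable def rootSpan (A : Set H.root) : Submodule ℂ L :=
  ⨆ γ : A, (rootSpace H γ.1.1).toSubmodule

theorem mem_rootSpan {A : Set H.root} {γ : H.root} (hγ : γ ∈ A) {x : L}
    (hx : x ∈ rootSpace H γ.1) : x ∈ rootSpan A :=
  Submodule.mem_iSup_of_mem (p := fun γ : A => (rootSpace H γ.1.1).toSubmodule) ⟨γ, hγ⟩ hx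

theorem rootSpan_induction {A : Set H.root} {p : L → Prop}
    (mem : ∀ γ ∈ A, ∀ x ∈ rootSpace H γ.1, p x) (zero : p 0)
    (add : ∀ x y, p x → p y → p (x + y)) {x : L} (hx : x ∈ rootSpan A) : p x :=
  Submodule.iSup_induction _ (motive := p) hx (fun γ => mem γ.1 γ.2) zero add

theorem killingForm_eq_zero_of_mem_rootSpan {A : Set H.root} {χ : H → ℂ}
    (h : ∀ γ ∈ A, (γ.1 : H → ℂ) + χ ≠ 0) {ξ z : L} (hξ : ξ ∈ rootSpan A)
    (hz : z ∈ rootSpace H χ) : killingForm ℂ L ξ z = 0 := by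
  refine rootSpan_induction (p := fun ξ => killingForm ℂ L ξ z = 0) ?_ (by simp) ?_ hξ
  · intro γ hγ x hx
    exact killingForm_apply_eq_zero_of_mem_rootSpace_of_add_ne_zero ℂ L H hx hz (h γ hγ)
  · intro x y hx hy
    simp [hx, hy]

variable [IsSimple ℂ L]

theorem root_apply_coroot_self (β : H.root) : β.1 (coroot β.1) = 2 :=
  root_apply_coroot (H.isNonZero_coe_root β)

/-- Allowing an arbitrary function `χ` lets this apply directly to the weight of an iterated
bracket, before knowing whether that weight is a root. -/
theorem IsLong.eq_zero_or_eq {β : H.root} (hβ : IsLong β) {χ : H → ℂ} {n : ℤ} (hn : 2 ≤ |n|)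
    (hχ : χ (coroot β.1) = n) {x : L} (hx : x ∈ rootSpace H χ) :
    x = 0 ∨ χ = β.1 ∨ χ = -β.1 := by
  have h0 : χ ≠ 0 := by
    rintro rfl
    have : n = 0 := by simpa using hχ.symm
    simp [this] at hn
  rcases eq_zero_or_exists_root h0 hx with h | ⟨γ, rfl⟩
  · exact .inl h
  right
  by_contra! hcon
  have := hβ.pairing_mem (γ := γ) (fun h => hcon.1 (by rw [h]))
    (fun h => hcon.2 (by rw [h, Weight.coe_neg]))
  rw [hχ] at this
  have h' : n = -1 ∨ n = 0 ∨ n = 1 := by exact_mod_cast this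
  rcases h' with rfl | rfl | rfl <;> simp at hn

theorem IsLong.eq_zero_of_three_le {β : H.root} (hβ : IsLong β) {χ : H → ℂ} {n : ℤ} (hn : 3 ≤ |n|)
    (hχ : χ (coroot β.1) = n) {x : L} (hx : x ∈ rootSpace H χ) : x = 0 := by
  have h2 := root_apply_coroot_self β
  rcases hβ.eq_zero_or_eq (by lia) hχ hx with h | h | h
  · exact h
  · rw [h, h2] at hχ
    have : n = 2 := by exact_mod_cast hχ.symm
    simp [this] at hn
  · rw [h, Pi.neg_apply, h2] at hχ
    have : n = -2 := by exact_mod_cast hχ.symm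
    simp [this] at hn

/-- The Killing form is nondegenerate and pairs `𝔤_γ` only with `𝔤_{-γ}`. Pairing with `𝔤_{-γ}` thus
serves as the test for a nonzero component at `γ`, in place of a projection. -/
theorem exists_killingForm_ne_zero {A : Set H.root} {ξ : L} (hξ : ξ ∈ rootSpan A) (h0 : ξ ≠ 0) :
    ∃ γ ∈ A, ∃ y ∈ rootSpace H (-γ.1 : H → ℂ), killingForm ℂ L ξ y ≠ 0 := by
  by_contra! hcon
  apply h0
  have hz : ∀ z : L, killingForm ℂ L ξ z = 0 := by
    intro z
    have hz : z ∈ ⨆ χ : H → ℂ, (rootSpace H χ).toSubmodule := by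
      rw [← LieSubmodule.iSup_toSubmodule, iSup_genWeightSpace_eq_top ℂ H L]
      trivial
    refine Submodule.iSup_induction _ (motive := fun z => killingForm ℂ L ξ z = 0) hz ?_
      (by simp) (fun x y hx hy => by simp [hx, hy])
    intro χ z hz
    by_cases h : ∃ γ ∈ A, (γ.1 : H → ℂ) + χ = 0
    · obtain ⟨γ, hγ, h⟩ := h
      rw [add_comm, add_eq_zero_iff_eq_neg] at h
      subst h
      exact hcon γ hγ z hz
    · push Not at h
      exact killingForm_eq_zero_of_mem_rootSpan h hξ hz
  have : ξ ∈ LinearMap.ker (killingForm ℂ L) := by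
    ext z; simpa using hz z
  simpa using this

variable (b : (rootSystem H).Base) (D : Finset H.root)

/-- An integral combination of simple roots in which the coefficients of the distinguished simple
roots add up to `j`. -/
def HasDegree (χ : H → ℂ) (j : ℤ) : Prop :=
  ∃ m : H.root → ℤ, χ = ⇑(∑ q ∈ b.support, m q • (rootSystem H).root q : Module.Dual ℂ H) ∧
    ∑ q ∈ D, m q = j

variable {b D} {χ ψ : H → ℂ} {i j k : ℤ}

theorem HasDegree.add (hχ : HasDegree b D χ i) (hψ : HasDegree b D ψ j) :
    HasDegree b D (χ + ψ) (i + j) := by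
  obtain ⟨m, rfl, rfl⟩ := hχ
  obtain ⟨n, rfl, rfl⟩ := hψ
  refine ⟨m + n, ?_, by simp [Finset.sum_add_distrib]⟩
  ext h
  simp [add_smul, Finset.sum_add_distrib]

theorem HasDegree.neg (hχ : HasDegree b D χ i) : HasDegree b D (-χ) (-i) := by
  obtain ⟨m, rfl, rfl⟩ := hχ
  refine ⟨-m, ?_, by simp⟩
  ext h
  simp

theorem hasDegree_iff {γ : H.root} : HasDegree b D γ.1 k ↔ γ ∈ rootsOfDegree b D k := by
  simp only [HasDegree, rootsOfDegree, Set.mem_ofPred_eq]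
  refine exists_congr fun m => and_congr_left fun _ => ⟨fun h => ?_, fun h => ?_⟩
  · ext x; exact congr_fun h x
  · rw [← h]; rfl

/-- Linear independence of the simple roots makes the coefficients vanish on the base, which
contains `D`. -/
theorem HasDegree.eq_zero (hD : D ⊆ b.support) (h : HasDegree b D 0 j) : j = 0 := by
  obtain ⟨m, hm, rfl⟩ := h
  have h0 : ∑ q ∈ b.support, (m q : ℂ) • (rootSystem H).root q = 0 := by
    ext x
    have := congr_fun hm x
    simpa using this.symm
  have := linearIndepOn_finset_iff.1 b.linearIndepOn_root (fun q => (m q : ℂ)) h0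
  exact Finset.sum_eq_zero fun q hq => by exact_mod_cast this q (hD hq)

theorem HasDegree.eq_zero_or_exists (hD : D ⊆ b.support) (hk : k ≠ 0) (h : HasDegree b D χ k)
    {x : L} (hx : x ∈ rootSpace H χ) :
    x = 0 ∨ ∃ γ ∈ rootsOfDegree b D k, (γ.1 : H → ℂ) = χ := by
  have h0 : χ ≠ 0 := by rintro rfl; exact hk (h.eq_zero hD)
  refine (eq_zero_or_exists_root h0 hx).imp_right ?_
  rintro ⟨γ, rfl⟩
  exact ⟨γ, hasDegree_iff.1 h, rfl⟩

theorem HasDegree.mem_gradedPiece_zero (h : HasDegree b D χ 0) {x : L} (hx : x ∈ rootSpace H χ) :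
    x ∈ gradedPiece b D 0 := by
  by_cases h0 : χ = 0
  · subst h0
    refine Submodule.mem_sup_left ?_
    rw [if_pos rfl]
    rw [rootSpace_zero_eq] at hx
    exact hx
  · rcases eq_zero_or_exists_root h0 hx with rfl | ⟨γ, rfl⟩
    · exact zero_mem _
    · refine Submodule.mem_sup_right ?_
      exact Submodule.mem_iSup_of_mem γ (Submodule.mem_iSup_of_mem (hasDegree_iff.1 h) hx)

theorem gradedPiece_eq_rootSpan (hk : k ≠ 0) :
    gradedPiece b D k = rootSpan (rootsOfDegree b D k) := by
  rw [gradedPiece, if_neg hk, bot_sup_eq, rootSpan, iSup_subtype']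

theorem mem_gradedPiece {γ : H.root} (hk : k ≠ 0) (hγ : γ ∈ rootsOfDegree b D k) {x : L}
    (hx : x ∈ rootSpace H γ.1) : x ∈ gradedPiece b D k := by
  rw [gradedPiece_eq_rootSpan hk]
  exact mem_rootSpan hγ hx

/-- A root vector of `β` kills `𝔤_γ` because `𝔤_k` is abelian. A nonzero vector of `𝔤_γ` is
therefore primitive for the `sl₂` of `β`, and its weight is a natural number by finite dimension. -/
theorem exists_nat_pairing (hk : k ≠ 0)
    (hab : ∀ x ∈ gradedPiece b D k, ∀ y ∈ gradedPiece b D k, ⁅x, y⁆ = 0) {γ β : H.root}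
    (hγ : γ ∈ rootsOfDegree b D k) (hβ : β ∈ rootsOfDegree b D k) :
    ∃ n : ℕ, γ.1 (coroot β.1) = n := by
  obtain ⟨v, hv, hv0⟩ := γ.1.exists_ne_zero
  obtain ⟨h, e, f, ht, he, hf⟩ := exists_isSl2Triple_of_weight_isNonZero (H.isNonZero_coe_root β)
  obtain rfl := ht.h_eq_coroot (H.isNonZero_coe_root β) he hf
  have hp : ht.HasPrimitiveVectorWith v (γ.1 (coroot β.1)) :=
    ⟨hv0, lie_eq_smul_of_mem_rootSpace hv _,
      hab _ (mem_gradedPiece hk hβ he) _ (mem_gradedPiece hk hγ hv)⟩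
  exact hp.exists_nat

theorem IsLong.pairing_of_mem_rootsOfDegree (hk : k ≠ 0)
    (hab : ∀ x ∈ gradedPiece b D k, ∀ y ∈ gradedPiece b D k, ⁅x, y⁆ = 0) {γ β : H.root}
    (hl : IsLong β) (hγ : γ ∈ rootsOfDegree b D k) (hβ : β ∈ rootsOfDegree b D k) :
    γ.1 (coroot β.1) = 0 ∨ γ.1 (coroot β.1) = 1 ∨ γ = β := by
  obtain ⟨n, hn⟩ := exists_nat_pairing hk hab hγ hβ
  by_cases h : γ = β
  · exact .inr (.inr h)
  by_cases h' : γ.1 = -β.1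
  · rw [h', Weight.coe_neg, Pi.neg_apply, root_apply_coroot_self] at hn
    have : (-2 : ℤ) = n := by exact_mod_cast hn
    lia
  rcases hl.pairing_mem (fun e => h (Subtype.ext e)) h' with h1 | h1 | h1
  · rw [h1] at hn
    have : (-1 : ℤ) = n := by exact_mod_cast hn
    lia
  · exact .inl h1
  · exact .inr (.inl h1)

variable (b D k) in
/-- The roots of degree `k` that are orthogonal to all roots of a given set. -/
def orthogonalRoots (R : Set H.root) : Set H.root :=
  {γ | γ ∈ rootsOfDegree b D k ∧ ∀ β ∈ R, γ.1 (coroot β.1) = 0}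

theorem HasDegree.mem_rootSpan (hD : D ⊆ b.support) (hk : k ≠ 0) {R : Set H.root}
    (h : HasDegree b D χ k) (hR : ∀ β ∈ R, χ (coroot β.1) = 0) {x : L}
    (hx : x ∈ rootSpace H χ) : x ∈ rootSpan (orthogonalRoots b D k R) := by
  rcases h.eq_zero_or_exists hD hk hx with rfl | ⟨γ, hγ, rfl⟩
  · exact zero_mem _
  · exact GradedSimple.mem_rootSpan (A := orthogonalRoots b D k R) ⟨hγ, hR⟩ hx

theorem expAd_mem_expGroup {x : L} (hx : x ∈ gradedPiece b D 0) : expAd x ∈ expGroup b D :=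
  Subgroup.subset_closure ⟨x, hx, rfl⟩

end Pieces

/-! ### Creating a pivot at a long root and eliminating with it. -/

section Orbits

open LieModule

variable {L : Type*} [LieRing L] [LieAlgebra ℂ L] [FiniteDimensional ℂ L] [IsSimple ℂ L]
  {H : LieSubalgebra ℂ L} [H.IsCartanSubalgebra]
  {b : (rootSystem H).Base} {D : Finset H.root} {k : ℤ}

theorem lie_mem_rootSpan_orthogonalRoots {R : Set H.root} (hD : D ⊆ b.support) (hk : k ≠ 0)
    {χ : H → ℂ} (hχ : HasDegree b D χ 0) (hR : ∀ β ∈ R, χ (coroot β.1) = 0) {x : L}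
    (hx : x ∈ rootSpace H χ) {ξ : L} (hξ : ξ ∈ rootSpan (orthogonalRoots b D k R)) :
    ⁅x, ξ⁆ ∈ rootSpan (orthogonalRoots b D k R) := by
  refine rootSpan_induction (p := fun ξ => ⁅x, ξ⁆ ∈ rootSpan (orthogonalRoots b D k R)) ?_
    (by simp) (fun y z hy hz => by rw [lie_add]; exact add_mem hy hz) hξ
  intro γ hγ y hy
  refine HasDegree.mem_rootSpan hD hk (χ := χ + (γ.1 : H → ℂ)) ?_ ?_
    (lie_mem_genWeightSpace_of_mem_genWeightSpace hx hy)
  · simpa using hχ.add (hasDegree_iff.2 hγ.1)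
  · intro β hβ
    rw [Pi.add_apply, hR β hβ, hγ.2 β hβ, add_zero]

/-- A root vector of weight `δ - γ` commutes with the root space of a long root `β` orthogonal to
both `γ` and `δ`. -/
theorem IsLong.lie_eq_zero {β γ δ : H.root} (hβ : IsLong β) (hγ : γ.1 (coroot β.1) = 0)
    (hδ : δ.1 (coroot β.1) = 0) (hne : γ ≠ δ) {x z : L}
    (hx : x ∈ rootSpace H ((δ.1 : H → ℂ) + -γ.1)) (hz : z ∈ rootSpace H β.1) : ⁅x, z⁆ = 0 := by
  have hw := lie_mem_genWeightSpace_of_mem_genWeightSpace hx hz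
  have h2 := root_apply_coroot_self β
  -- The bracket has weight `δ - γ + β`, pairing to 2. Weight `β` would mean `γ = δ`, and `-β` pairs
  -- to -2.
  rcases hβ.eq_zero_or_eq (n := 2) (by simp) (by simp [hγ, hδ, h2]) hw with h | h | h
  · exact h
  · exfalso; apply hne; ext h'
    have := congr_fun h h'
    simp only [Pi.add_apply, Pi.neg_apply] at this
    linear_combination -this
  · have := congr_fun h (coroot β.1)
    simp only [Pi.add_apply, Pi.neg_apply, hγ, hδ, h2] at this
    norm_num at this

/-- If `γ` is not orthogonal to the long root `β`, and `ξ` has a nonzero component at `γ`, then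
some element of the group moves `ξ` to a vector with a nonzero component at `β`. -/
theorem exists_expGroup_killingForm_ne_zero (hD : D ⊆ b.support) (hk : k ≠ 0)
    (hab : ∀ x ∈ gradedPiece b D k, ∀ y ∈ gradedPiece b D k, ⁅x, y⁆ = 0)
    {R : Set H.root} (hR : ∀ β ∈ R, IsLong β)
    {β γ : H.root} (hβ : β ∈ orthogonalRoots b D k R) (hγ : γ ∈ orthogonalRoots b D k R)
    (hl : IsLong β) (hγβ : γ.1 (coroot β.1) = 1)
    {ξ : L} (hξ : ξ ∈ rootSpan (orthogonalRoots b D k R)) {y : L}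
    (hy : y ∈ rootSpace H (-γ.1 : H → ℂ)) (hξy : killingForm ℂ L ξ y ≠ 0) :
    ∃ g ∈ expGroup b D,
      (∀ α ∈ R, ∀ z ∈ rootSpace H α.1, (g : Module.End ℂ L) z = z) ∧
      (g : Module.End ℂ L) ξ ∈ rootSpan (orthogonalRoots b D k R) ∧
      ∃ f ∈ rootSpace H (-β.1 : H → ℂ), killingForm ℂ L ((g : Module.End ℂ L) ξ) f ≠ 0 := by
  have h2 := root_apply_coroot_self β
  have hne : γ ≠ β := by rintro rfl; rw [h2] at hγβ; norm_num at hγβ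
  obtain ⟨h, e, f, ht, he, hf⟩ := exists_isSl2Triple_of_weight_isNonZero (H.isNonZero_coe_root β)
  obtain rfl := ht.h_eq_coroot (H.isNonZero_coe_root β) he hf
  -- This choice gives `⁅x, f⁆ = -y`, so by invariance `B(⁅x, ξ⁆, f) = B(ξ, y) ≠ 0`: the first-order
  -- term of `exp (ad x) ξ` reaches `β`.
  set x := ⁅e, y⁆ with hxdef
  have hx : x ∈ rootSpace H ((β.1 : H → ℂ) + -γ.1) :=
    lie_mem_genWeightSpace_of_mem_genWeightSpace he hy
  have hdeg : HasDegree b D ((β.1 : H → ℂ) + -γ.1) 0 := by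
    simpa using (hasDegree_iff.2 hβ.1).add (hasDegree_iff.2 hγ.1).neg
  -- The weight `-γ - β` pairs to -1 - 2 = -3.
  have hyf : ⁅y, f⁆ = 0 :=
    hl.eq_zero_of_three_le (n := -3) (by simp) (by simp [hγβ, h2]; norm_num)
      (lie_mem_genWeightSpace_of_mem_genWeightSpace hy hf)
  have hxf : ⁅x, f⁆ = -y := by
    have hhy : ⁅(coroot β.1 : L), y⁆ = -y := by
      have := lie_eq_smul_of_mem_rootSpace hy (coroot β.1)
      simpa [hγβ] using this
    rw [hxdef, lie_lie, hyf, lie_zero, zero_sub, ht.lie_e_f, lie_skew, hhy]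
  have hB : killingForm ℂ L ⁅x, ξ⁆ f ≠ 0 := by
    rw [← lie_skew, map_neg, LinearMap.neg_apply, LieModule.traceForm_apply_lie_apply, hxf]
    simpa using hξy
  have hmem (η : L) (hη : η ∈ rootSpan (orthogonalRoots b D k R)) :
      ⁅x, η⁆ ∈ rootSpan (orthogonalRoots b D k R) :=
    lie_mem_rootSpan_orthogonalRoots hD hk hdeg
      (fun α hα => by simp [hβ.2 α hα, hγ.2 α hα]) hx hη
  -- Each `ad x` raises the pairing with the coroot of `β` by 1, and it starts at `n ≥ 0`; after
  -- three steps it exceeds what any root allows.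
  have hcube : ⁅x, ⁅x, ⁅x, ξ⁆⁆⁆ = 0 := by
    refine rootSpan_induction (p := fun ξ => ⁅x, ⁅x, ⁅x, ξ⁆⁆⁆ = 0) ?_ (by simp)
      (fun y z hy hz => by simp [hy, hz]) hξ
    intro δ hδ v hv
    obtain ⟨n, hn⟩ := exists_nat_pairing hk hab hδ.1 hβ.1
    refine hl.eq_zero_of_three_le (n := 3 + n) (by rw [abs_of_nonneg (by positivity)]; lia) ?_
      (lie_mem_genWeightSpace_of_mem_genWeightSpace hx
        (lie_mem_genWeightSpace_of_mem_genWeightSpace hx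
          (lie_mem_genWeightSpace_of_mem_genWeightSpace hx hv)))
    simp only [Pi.add_apply, Pi.neg_apply, h2, hγβ, hn]
    push_cast; ring
  have hexp (c : ℂ) : (expAd (c • x) : Module.End ℂ L) ξ =
      ξ + c • ⁅x, ξ⁆ + (c ^ 2 * 2⁻¹) • ⁅x, ⁅x, ξ⁆⁆ := by
    rw [expAd_apply_of_lie_lie_lie_eq_zero (by simp [hcube])]
    simp only [smul_lie, lie_smul, smul_smul]
    congr 2; ring
  -- The pairing is quadratic in `c` with nonzero linear coefficient, so it cannot vanish at both 1
  -- and -1.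
  have hex : ∃ c : ℂ, killingForm ℂ L ((expAd (c • x) : Module.End ℂ L) ξ) f ≠ 0 := by
    by_contra! hcon
    apply hB
    have h1 := hcon 1
    have h3 := hcon (-1)
    rw [hexp] at h1 h3
    simp only [map_add, map_smul, LinearMap.add_apply, LinearMap.smul_apply, smul_eq_mul] at h1 h3
    linear_combination (h1 - h3) / 2
  obtain ⟨c, hc⟩ := hex
  refine ⟨expAd (c • x), expAd_mem_expGroup ?_, ?_, ?_, f, hf, hc⟩
  · exact Submodule.smul_mem _ _ (hdeg.mem_gradedPiece_zero hx)
  · intro α hα z hz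
    apply expAd_apply_of_lie_eq_zero
    rw [smul_lie, (hR α hα).lie_eq_zero (hγ.2 α hα) (hβ.2 α hα) hne hx hz, smul_zero]
  · rw [hexp]
    exact add_mem (add_mem hξ (Submodule.smul_mem _ _ (hmem _ hξ)))
      (Submodule.smul_mem _ _ (hmem _ (hmem _ hξ)))

/-- The decomposition of a sum of root spaces of degree `k` according to the pairing with a
long root of degree `k`. -/
theorem exists_decomposition (hk : k ≠ 0)
    (hab : ∀ x ∈ gradedPiece b D k, ∀ y ∈ gradedPiece b D k, ⁅x, y⁆ = 0)
    {R : Set H.root} {β : H.root} (hβ : β ∈ rootsOfDegree b D k) (hl : IsLong β)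
    {ξ : L} (hξ : ξ ∈ rootSpan (orthogonalRoots b D k R)) :
    ∃ a ∈ rootSpace H β.1,
      ∃ v ∈ rootSpan {γ | γ ∈ orthogonalRoots b D k R ∧ γ.1 (coroot β.1) = 1},
      ∃ w ∈ rootSpan (orthogonalRoots b D k (insert β R)), ξ = a + v + w := by
  refine rootSpan_induction (p := fun ξ => ∃ a ∈ rootSpace H β.1,
      ∃ v ∈ rootSpan {γ | γ ∈ orthogonalRoots b D k R ∧ γ.1 (coroot β.1) = 1},
      ∃ w ∈ rootSpan (orthogonalRoots b D k (insert β R)), ξ = a + v + w) ?_ ?_ ?_ hξ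
  · intro γ hγ x hx
    rcases hl.pairing_of_mem_rootsOfDegree hk hab hγ.1 hβ with h | h | rfl
    · refine ⟨0, zero_mem _, 0, zero_mem _, x,
        mem_rootSpan (A := orthogonalRoots b D k (insert β R)) ⟨hγ.1, ?_⟩ hx, by simp⟩
      rintro α (rfl | hα)
      exacts [h, hγ.2 α hα]
    · exact ⟨0, zero_mem _, x, mem_rootSpan (A := {γ | γ ∈ orthogonalRoots b D k R ∧
        γ.1 (coroot β.1) = 1}) ⟨hγ, h⟩ hx, 0, zero_mem _, by simp⟩
    · exact ⟨x, hx, 0, zero_mem _, 0, zero_mem _, by simp⟩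
  · exact ⟨0, zero_mem _, 0, zero_mem _, 0, zero_mem _, by simp⟩
  · rintro x y ⟨a, ha, v, hv, w, hw, rfl⟩ ⟨a', ha', v', hv', w', hw', rfl⟩
    exact ⟨a + a', add_mem ha ha', v + v', add_mem hv hv', w + w', add_mem hw hw', by abel⟩

/-- A vector with a nonzero component at the long root `β` can be moved into the sum of the root
space of `β` and the root spaces of the roots orthogonal to `β`. -/
theorem exists_expGroup_apply_eq_add (hD : D ⊆ b.support) (hk : k ≠ 0)
    (hab : ∀ x ∈ gradedPiece b D k, ∀ y ∈ gradedPiece b D k, ⁅x, y⁆ = 0)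
    {R : Set H.root} (hR : ∀ β ∈ R, IsLong β)
    {β : H.root} (hβ : β ∈ orthogonalRoots b D k R) (hl : IsLong β)
    {ξ : L} (hξ : ξ ∈ rootSpan (orthogonalRoots b D k R)) {f : L}
    (hf : f ∈ rootSpace H (-β.1 : H → ℂ)) (hξf : killingForm ℂ L ξ f ≠ 0) :
    ∃ g ∈ expGroup b D,
      (∀ α ∈ R, ∀ z ∈ rootSpace H α.1, (g : Module.End ℂ L) z = z) ∧
      ∃ a ∈ rootSpace H β.1, ∃ w ∈ rootSpan (orthogonalRoots b D k (insert β R)),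
        (g : Module.End ℂ L) ξ = a + w := by
  have h2 := root_apply_coroot_self β
  obtain ⟨a, ha, v, hv, w, hw, rfl⟩ := exists_decomposition hk hab hβ.1 hl hξ
  set A := {γ | γ ∈ orthogonalRoots b D k R ∧ γ.1 (coroot β.1) = 1} with hA
  have hAk : ∀ γ ∈ A, γ ∈ rootsOfDegree b D k := fun γ hγ => hγ.1.1
  have hvk : v ∈ gradedPiece b D k :=
    rootSpan_induction (p := fun v => v ∈ gradedPiece b D k)
      (fun γ hγ x hx => mem_gradedPiece hk (hAk γ hγ) hx) (zero_mem _)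
      (fun _ _ => add_mem) hv
  obtain ⟨h, e, f', ht, he, hf'⟩ :=
    exists_isSl2Triple_of_weight_isNonZero (H.isNonZero_coe_root β)
  obtain rfl := ht.h_eq_coroot (H.isNonZero_coe_root β) he hf'
  -- The weights in `v` and `w` pair to 1 and 0, never 2, so only `a` can contribute to `B(ξ, f)`.
  have ha0 : a ≠ 0 := by
    rintro rfl
    apply hξf
    have hne : ∀ γ : H.root, γ.1 (coroot β.1) ≠ 2 → (γ.1 : H → ℂ) + -β.1 ≠ 0 := by
      intro γ hγ h0
      have := congr_fun h0 (coroot β.1)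
      simp only [Pi.add_apply, Pi.neg_apply, Pi.zero_apply, h2] at this
      exact hγ (by linear_combination this)
    rw [zero_add, map_add, LinearMap.add_apply,
      killingForm_eq_zero_of_mem_rootSpan (fun γ hγ => hne γ ?_) hv hf,
      killingForm_eq_zero_of_mem_rootSpan (fun γ hγ => hne γ ?_) hw hf, add_zero]
    · rw [hγ.2 β (Set.mem_insert _ _)]; norm_num
    · rw [hγ.2]; norm_num
  obtain ⟨s, hs⟩ : ∃ s : ℂ, s • a = e := by
    obtain ⟨s, hs⟩ := (finrank_eq_one_iff_of_nonzero' (⟨a, ha⟩ : rootSpace H β.1)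
      (by simpa using ha0)).1 (finrank_rootSpace_eq_one β.1 (H.isNonZero_coe_root β)) ⟨e, he⟩
    exact ⟨s, congr_arg Subtype.val hs⟩
  -- The scaling makes `⁅a, F⁆` the coroot of `β`, which acts on `v` as 1. With `x = ⁅F, v⁆` this
  -- gives `⁅x, a⁆ = -v`, cancelling `v` at first order.
  set F := s • f' with hF
  have hFm : F ∈ rootSpace H (-β.1 : H → ℂ) := SMulMemClass.smul_mem s hf'
  have haF : ⁅a, F⁆ = (coroot β.1 : L) := by
    rw [hF, lie_smul, ← smul_lie, hs, ht.lie_e_f]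
  set x := ⁅F, v⁆ with hxdef
  have hdeg (γ : H.root) (hγ : γ ∈ A) : HasDegree b D (-(β.1 : H → ℂ) + γ.1) 0 := by
    simpa using (hasDegree_iff.2 hβ.1).neg.add (hasDegree_iff.2 (hAk γ hγ))
  have hx0 : x ∈ gradedPiece b D 0 :=
    rootSpan_induction (p := fun v => ⁅F, v⁆ ∈ gradedPiece b D 0)
      (fun γ hγ y hy => (hdeg γ hγ).mem_gradedPiece_zero
        (lie_mem_genWeightSpace_of_mem_genWeightSpace hFm hy)) (by simp)
      (fun y z hy hz => by rw [lie_add]; exact add_mem hy hz) hv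
  have hxR : ∀ α ∈ R, ∀ z ∈ rootSpace H α.1, ⁅x, z⁆ = 0 := by
    intro α hα z hz
    refine rootSpan_induction (p := fun v => ⁅⁅F, v⁆, z⁆ = 0) ?_ (by simp)
      (fun y y' hy hy' => by rw [lie_add, add_lie, hy, hy', add_zero]) hv
    intro γ hγ y hy
    have hne : β ≠ γ := by
      rintro rfl
      have := hγ.2
      rw [h2] at this; norm_num at this
    refine (hR α hα).lie_eq_zero (hβ.2 α hα) (hγ.1.2 α hα) hne ?_ hz
    rw [add_comm]
    exact lie_mem_genWeightSpace_of_mem_genWeightSpace hFm hy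
  have hxa : ⁅x, a⁆ = -v := by
    have hav : ⁅a, v⁆ = 0 := hab _ (mem_gradedPiece hk hβ.1 ha) _ hvk
    have hhv : ⁅(coroot β.1 : L), v⁆ = v := by
      refine rootSpan_induction (p := fun v => ⁅(coroot β.1 : L), v⁆ = v) ?_ (by simp)
        (fun y y' hy hy' => by rw [lie_add, hy, hy']) hv
      intro γ hγ y hy
      have := lie_eq_smul_of_mem_rootSpace hy (coroot β.1)
      rw [hγ.2, one_smul] at this
      exact this
    rw [← lie_skew, hxdef, leibniz_lie, haF, hav, lie_zero, add_zero, hhv]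
  -- The weight `-β + γ + δ` has degree `k` and pairs to -2 + 1 + 0 = -1, which no root of `Δ_k`
  -- does.
  have hxw : ∀ w ∈ rootSpan (orthogonalRoots b D k (insert β R)), ⁅x, w⁆ = 0 := by
    intro w hw
    refine rootSpan_induction (p := fun w => ⁅x, w⁆ = 0) ?_ (by simp)
      (fun y y' hy hy' => by rw [lie_add, hy, hy', add_zero]) hw
    intro δ hδ z hz
    refine rootSpan_induction (p := fun v => ⁅⁅F, v⁆, z⁆ = 0) ?_ (by simp)
      (fun y y' hy hy' => by rw [lie_add, add_lie, hy, hy', add_zero]) hv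
    intro γ hγ y hy
    have hdeg' : HasDegree b D (-(β.1 : H → ℂ) + γ.1 + δ.1) k := by
      simpa using (hdeg γ hγ).add (hasDegree_iff.2 hδ.1)
    rcases hdeg'.eq_zero_or_exists hD hk (lie_mem_genWeightSpace_of_mem_genWeightSpace
      (lie_mem_genWeightSpace_of_mem_genWeightSpace hFm hy) hz) with h0 | ⟨ε, hε, h0⟩
    · exact h0
    · obtain ⟨n, hn⟩ := exists_nat_pairing hk hab hε hβ.1
      rw [h0] at hn
      simp only [Pi.add_apply, Pi.neg_apply, h2, hγ.2, hδ.2 β (Set.mem_insert _ _)] at hn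
      have : (-1 : ℤ) = n := by
        have h3 : (-1 : ℂ) = n := by rw [← hn]; norm_num
        exact_mod_cast h3
      lia
  -- Here the pairing is -2 + 1 + 1 = 0, so the error term is already orthogonal to `β`, and `hxw`
  -- shows that `x` kills it.
  have hxv : ⁅x, v⁆ ∈ rootSpan (orthogonalRoots b D k (insert β R)) := by
    refine rootSpan_induction
      (p := fun u => ⁅x, u⁆ ∈ rootSpan (orthogonalRoots b D k (insert β R))) ?_ (by simp)
      (fun y y' hy hy' => by rw [lie_add]; exact add_mem hy hy') hv
    intro δ hδ z hz
    refine rootSpan_induction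
      (p := fun v => ⁅⁅F, v⁆, z⁆ ∈ rootSpan (orthogonalRoots b D k (insert β R))) ?_ (by simp)
      (fun y y' hy hy' => by rw [lie_add, add_lie]; exact add_mem hy hy') hv
    intro γ hγ y hy
    refine HasDegree.mem_rootSpan hD hk (χ := -(β.1 : H → ℂ) + (γ.1 : H → ℂ) + (δ.1 : H → ℂ)) ?_ ?_
      (lie_mem_genWeightSpace_of_mem_genWeightSpace
        (lie_mem_genWeightSpace_of_mem_genWeightSpace hFm hy) hz)
    · simpa using (hdeg γ hγ).add (hasDegree_iff.2 hδ.1.1)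
    · rintro α (rfl | hα)
      · simp only [Pi.add_apply, Pi.neg_apply, h2, hγ.2, hδ.2]; norm_num
      · simp [hβ.2 α hα, hγ.1.2 α hα, hδ.1.2 α hα]
  have hxξ : ⁅x, a + v + w⁆ = -v + ⁅x, v⁆ := by
    rw [lie_add, lie_add, hxa, hxw w hw, add_zero]
  have hxxξ : ⁅x, ⁅x, a + v + w⁆⁆ = -⁅x, v⁆ := by
    rw [hxξ, lie_add, lie_neg, hxw _ hxv, add_zero]
  refine ⟨expAd x, expAd_mem_expGroup hx0,
    fun α hα z hz => expAd_apply_of_lie_eq_zero (hxR α hα z hz), a, ha,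
    w + (2⁻¹ : ℂ) • ⁅x, v⁆, add_mem hw (Submodule.smul_mem _ _ hxv), ?_⟩
  rw [expAd_apply_of_lie_lie_lie_eq_zero (by rw [hxxξ, lie_neg, hxw _ hxv, neg_zero]), hxxξ, hxξ]
  module

end Orbits

/-! ### Maximality, the induction, and normalisation by the torus. -/

section NormalForm

open LieModule

variable {L : Type*} [LieRing L] [LieAlgebra ℂ L] [FiniteDimensional ℂ L] [IsSimple ℂ L]
  {H : LieSubalgebra ℂ L} [H.IsCartanSubalgebra]
  {b : (rootSystem H).Base} {D : Finset H.root} {k : ℤ}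

theorem StronglyOrthogonal.symm {α β : H.root} (h : StronglyOrthogonal α β) :
    StronglyOrthogonal β α := by
  obtain ⟨⟨h1, h2⟩, h3, h4⟩ := h
  refine ⟨⟨by rwa [add_comm], by rwa [add_comm]⟩, ?_, ?_⟩
  · rwa [← neg_sub, neg_ne_zero]
  · rw [← neg_sub]
    rintro ⟨γ, hγ⟩
    apply h4
    -- Reflecting `γ` in itself produces the root `-γ`.
    refine ⟨(rootSystem H).reflectionPerm γ γ, ?_⟩
    rw [RootPairing.root_reflectionPerm, RootPairing.reflection_apply_self, hγ, neg_neg]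

theorem StronglyOrthogonal.pairing_eq_zero {α β : H.root} (h : StronglyOrthogonal α β) :
    α.1 (coroot β.1) = 0 := by
  have := (rootSystem H).pairing_eq_zero_of_add_notMem_of_sub_notMem (i := α) (j := β)
    (by rintro rfl; exact h.2.1 (sub_self _))
    (fun e => h.1.1 (by rw [e, neg_add_cancel])) h.1.2 h.2.2
  simpa using this

/-- If `γ ± β` were a root, it would pair to ±2 with the coroot of `β`. Since `β` is long it would
equal `β` or `-β`; comparing pairings fixes the sign and leaves `γ = 0`. -/
theorem IsLong.stronglyOrthogonal {γ β : H.root} (hβ : IsLong β) (h : γ.1 (coroot β.1) = 0) :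
    StronglyOrthogonal γ β := by
  have h2 := root_apply_coroot_self β
  have hnz : (γ.1 : H → ℂ) ≠ 0 := H.isNonZero_coe_root γ
  have key (δ : H.root) (s : ℂ) (n : ℤ) (hs : s * 2 = n) (hn : 2 ≤ |n|) (hs' : s = 1 ∨ s = -1)
      (hδ : ∀ x : H, δ.1 x = γ.1 x + s * β.1 x) : False := by
    obtain ⟨v, hv, hv0⟩ := δ.1.exists_ne_zero
    rcases hβ.eq_zero_or_eq hn (by rw [hδ, h, h2, zero_add, hs]) hv with h3 | h3 | h3
    · exact hv0 h3
    all_goals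
      have h4 := congr_fun h3 (coroot β.1)
      simp only [hδ, h, h2, Pi.neg_apply] at h4
      rcases hs' with rfl | rfl <;> first
        | (norm_num at h4; done)
        | (apply hnz; ext x
           have h5 := congr_fun h3 x
           simp only [hδ, Pi.neg_apply] at h5
           simp only [Pi.zero_apply]
           linear_combination h5)
  refine ⟨⟨fun h0 => ?_, ?_⟩, fun h0 => ?_, ?_⟩
  · have : γ.1 (coroot β.1) + β.1 (coroot β.1) = 0 := congr($h0 (coroot β.1))
    rw [h, h2] at this; norm_num at this
  · rintro ⟨δ, hδ⟩
    refine key δ 1 2 (by norm_num) (by norm_num) (.inl rfl) fun x => ?_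
    have : δ.1 x = γ.1 x + β.1 x := congr($hδ x)
    rw [this, one_mul]
  · have : γ.1 (coroot β.1) - β.1 (coroot β.1) = 0 := congr($h0 (coroot β.1))
    rw [h, h2] at this; norm_num at this
  · rintro ⟨δ, hδ⟩
    refine key δ (-1) (-2) (by norm_num) (by norm_num) (.inr rfl) fun x => ?_
    have : δ.1 x = γ.1 x - β.1 x := congr($hδ x)
    rw [this]; ring

/-- A root orthogonal to all of `S` would be strongly orthogonal to it, hence in `S` by maximality;
but it pairs to 2 with its own coroot. -/
theorem IsMaximalStronglyOrthogonal.exists_pairing_ne_zero {Δ : Set H.root} {S : Finset H.root}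
    (hmax : IsMaximalStronglyOrthogonal Δ S) (hlong : ∀ β ∈ S, IsLong β) {γ : H.root}
    (hγ : γ ∈ Δ) : ∃ β ∈ S, γ.1 (coroot β.1) ≠ 0 := by
  classical
  by_contra! hcon
  have hins : insert γ S ⊆ S := by
    refine hmax.2 ⟨?_, ?_⟩ (Finset.subset_insert γ S)
    · rw [Finset.coe_insert]
      exact Set.insert_subset hγ hmax.1.1
    · rw [Finset.coe_insert]
      refine hmax.1.2.insert fun β hβ _ => ?_
      have := (hlong β hβ).stronglyOrthogonal (hcon β hβ)
      exact ⟨this, this.symm⟩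
  have := hcon γ (hins (Finset.mem_insert_self _ _))
  rw [root_apply_coroot_self] at this
  norm_num at this

theorem IsNormalizedRootVector.ne_zero {φ : H.root} {x : L} (h : IsNormalizedRootVector φ x) :
    x ≠ 0 := by
  rintro rfl
  obtain ⟨-, y, -, hy⟩ := h
  rw [zero_lie] at hy
  have h0 : dualElement φ = 0 := Subtype.ext hy.symm
  apply root_dualElement_ne_zero φ
  rw [h0, ← Weight.toLinear_apply, map_zero]

theorem IsNormalizedRootVector.exists_smul_eq {φ : H.root} {x : L}
    (h : IsNormalizedRootVector φ x) {a : L} (ha : a ∈ rootSpace H φ.1) : ∃ s : ℂ, a = s • x := by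
  obtain ⟨s, hs⟩ := (finrank_eq_one_iff_of_nonzero' (⟨x, h.1⟩ : rootSpace H φ.1)
    (by simpa using h.ne_zero)).1 (finrank_rootSpace_eq_one φ.1 (H.isNonZero_coe_root φ)) ⟨a, ha⟩
  exact ⟨s, (congr_arg Subtype.val hs).symm⟩

/-- A vector of degree `k` that is orthogonal to a part of `S` can be moved into the span of the
root vectors of the other elements of `S` by a group element fixing the former root spaces. -/
theorem exists_expGroup_apply_eq_sum (hD : D ⊆ b.support) (hk : k ≠ 0)
    (hab : ∀ x ∈ gradedPiece b D k, ∀ y ∈ gradedPiece b D k, ⁅x, y⁆ = 0)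
    {S : Finset H.root} (hmax : IsMaximalStronglyOrthogonal (rootsOfDegree b D k) S)
    (hlong : ∀ β ∈ S, IsLong β) {e : H.root → L}
    (he : ∀ β ∈ S, IsNormalizedRootVector β (e β)) (T : Finset H.root) (hT : T ⊆ S)
    {ξ : L} (hξ : ξ ∈ rootSpan (orthogonalRoots b D k ((S : Set H.root) \ T))) :
    ∃ g ∈ expGroup b D,
      (∀ α ∈ (S : Set H.root) \ T, ∀ z ∈ rootSpace H α.1, (g : Module.End ℂ L) z = z) ∧
      ∃ c : H.root → ℂ, (g : Module.End ℂ L) ξ = ∑ β ∈ T, c β • e β := by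
  classical
  induction T using Finset.strongInduction generalizing ξ with
  | H T ih =>
  by_cases h0 : ξ = 0
  · exact ⟨1, one_mem _, fun _ _ _ _ => rfl, 0, by simp [h0]⟩
  set R := (S : Set H.root) \ T with hR
  have hRl : ∀ β ∈ R, IsLong β := fun β hβ => hlong β hβ.1
  have hort : ∀ β ∈ T, β ∈ orthogonalRoots b D k R := fun β hβ =>
    ⟨hmax.1.1 (hT hβ), fun α hα => (hmax.1.2 (hT hβ) hα.1
      (by rintro rfl; exact hα.2 hβ)).pairing_eq_zero⟩
  obtain ⟨β, hβ, g₁, hg₁, hfix₁, hmem₁, f, hf, hgf⟩ : ∃ β ∈ T, ∃ g ∈ expGroup b D,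
      (∀ α ∈ R, ∀ z ∈ rootSpace H α.1, (g : Module.End ℂ L) z = z) ∧
      (g : Module.End ℂ L) ξ ∈ rootSpan (orthogonalRoots b D k R) ∧
      ∃ f ∈ rootSpace H (-β.1 : H → ℂ), killingForm ℂ L ((g : Module.End ℂ L) ξ) f ≠ 0 := by
    obtain ⟨γ, hγ, y, hy, hξy⟩ := exists_killingForm_ne_zero hξ h0
    obtain ⟨β, hβS, hne⟩ := hmax.exists_pairing_ne_zero hlong hγ.1
    have hβT : β ∈ T := by
      by_contra hβT
      exact hne (hγ.2 β ⟨hβS, hβT⟩)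
    refine ⟨β, hβT, ?_⟩
    rcases (hlong β hβS).pairing_of_mem_rootsOfDegree hk hab hγ.1 (hort β hβT).1 with h | h | rfl
    · exact absurd h hne
    · exact exists_expGroup_killingForm_ne_zero hD hk hab hRl (hort β hβT) hγ (hlong β hβS) h
        hξ hy hξy
    · exact ⟨1, one_mem _, fun _ _ _ _ => rfl, hξ, y, hy, hξy⟩
  obtain ⟨g₂, hg₂, hfix₂, a, ha, w, hw, hg₂ξ⟩ := exists_expGroup_apply_eq_add hD hk hab hRl
    (hort β hβ) (hlong β (hT hβ)) hmem₁ hf hgf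
  have hins : (S : Set H.root) \ ↑(T.erase β) = insert β R := by
    rw [hR, Finset.coe_erase, Set.sdiff_sdiff_right]
    ext α
    simp only [Set.mem_union, Set.mem_sdiff, Set.mem_inter_iff, Set.mem_insert_iff,
      Set.mem_singleton_iff, Finset.mem_coe]
    constructor
    · rintro (h | h)
      exacts [.inr h, .inl h.2]
    · rintro (rfl | h)
      exacts [.inr ⟨hT hβ, rfl⟩, .inl h]
  obtain ⟨g₃, hg₃, hfix₃, c, hc⟩ := ih (T.erase β) (Finset.erase_ssubset hβ)
    ((Finset.erase_subset β T).trans hT) (ξ := w) (by rwa [hins])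
  rw [hins] at hfix₃
  obtain ⟨s, rfl⟩ := (he β (hT hβ)).exists_smul_eq ha
  -- `g₃` comes from the induction for `T.erase β`, so it fixes the root space of `β` and leaves the
  -- pivot `s • e β` intact.
  refine ⟨g₃ * (g₂ * g₁), mul_mem hg₃ (mul_mem hg₂ hg₁), ?_, Function.update c β s, ?_⟩
  · intro α hα z hz
    rw [Units.val_mul, Units.val_mul, Module.End.mul_apply, Module.End.mul_apply,
      hfix₁ α hα z hz, hfix₂ α hα z hz, hfix₃ α (Set.mem_insert_of_mem _ hα) z hz]
  · rw [Units.val_mul, Units.val_mul, Module.End.mul_apply, Module.End.mul_apply, hg₂ξ, map_add,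
      hfix₃ β (Set.mem_insert _ _) _ ha, hc, ← Finset.add_sum_erase T _ hβ, Function.update_self]
    congr 1
    refine Finset.sum_congr rfl fun α hα => ?_
    rw [Function.update_of_ne (Finset.ne_of_mem_erase hα)]

/-- The nonzero coefficients of a combination of root vectors of pairwise orthogonal roots can be
normalised to `1` by an element of the torus. -/
theorem exists_expGroup_normalize {S : Finset H.root}
    (hS : (S : Set H.root).Pairwise StronglyOrthogonal) {e : H.root → L}
    (he : ∀ β ∈ S, e β ∈ rootSpace H β.1) (c : H.root → ℂ) :
    ∃ g ∈ expGroup b D, (g : Module.End ℂ L) (∑ β ∈ S, c β • e β) =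
      ∑ β ∈ S, (if c β = 0 then 0 else 1 : ℂ) • e β := by
  classical
  -- The halving compensates `β(coroot β) = 2`; by orthogonality `β x = -log (c β)`, so `exp (ad x)`
  -- scales `e β` by `(c β)⁻¹` when `c β ≠ 0`. Zero coefficients stay zero whatever the scaling.
  set x : H := ∑ β ∈ S, (-(Complex.log (c β)) / 2) • coroot β.1
  refine ⟨expAd (x : L), expAd_mem_expGroup ?_, ?_⟩
  · refine Submodule.mem_sup_left ?_
    rw [if_pos rfl]
    exact x.2
  · rw [map_sum]
    refine Finset.sum_congr rfl fun β hβ => ?_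
    have hx : β.1 x = -Complex.log (c β) := by
      rw [← Weight.toLinear_apply, map_sum, Finset.sum_eq_single_of_mem β hβ]
      · rw [map_smul, Weight.toLinear_apply, root_apply_coroot_self, smul_eq_mul]
        ring
      · intro α hα hne
        rw [map_smul, Weight.toLinear_apply, (hS hβ hα hne.symm).pairing_eq_zero, smul_zero]
    have hlie : ⁅(x : L), e β⁆ = (-Complex.log (c β)) • e β := by
      rw [← hx]
      exact lie_eq_smul_of_mem_rootSpace (he β hβ) x
    rw [map_smul, expAd_apply_of_lie_eq_smul hlie, smul_smul]
    split_ifs with h0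
    · simp [h0]
    · rw [Complex.exp_neg, Complex.exp_log h0, mul_inv_cancel₀ h0]

end NormalForm

end GradedSimple

theorem mainTheorem10 {L : Type*} [LieRing L] [LieAlgebra ℂ L] [FiniteDimensional ℂ L]
    [LieAlgebra.IsSimple ℂ L]
    (H : LieSubalgebra ℂ L) [H.IsCartanSubalgebra]
    (b : (LieAlgebra.IsKilling.rootSystem H).Base)
    (D : Finset H.root) (hD : D ⊆ b.support)
    (k : ℤ) (hk : 0 < k)
    (hab : ∀ x ∈ GradedSimple.gradedPiece b D k, ∀ y ∈ GradedSimple.gradedPiece b D k,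
      ⁅x, y⁆ = 0)
    (S : Finset H.root)
    (hmax : GradedSimple.IsMaximalStronglyOrthogonal (GradedSimple.rootsOfDegree b D k) S)
    (hlong : ∀ β ∈ S, GradedSimple.IsLong β)
    (e : H.root → L) (he : ∀ β ∈ S, GradedSimple.IsNormalizedRootVector β (e β))
    (ξ : L) (hξ : ξ ∈ GradedSimple.gradedPiece b D k) :
    ∃ g ∈ GradedSimple.expGroup b D, ∃ c : H.root → ℂ,
      (∀ β, c β = 0 ∨ c β = 1) ∧
      (g : Module.End ℂ L) ξ = ∑ β ∈ S, c β • e β := by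
  -- The induction starts at `T = S`, where no orthogonality is required because `S \ S` is empty.
  have hξ' : ξ ∈ GradedSimple.rootSpan
      (GradedSimple.orthogonalRoots b D k ((S : Set H.root) \ S)) := by
    rw [GradedSimple.gradedPiece_eq_rootSpan hk.ne'] at hξ
    convert hξ using 2
    ext γ
    simp [GradedSimple.orthogonalRoots]
  obtain ⟨g₁, hg₁, -, c, hc⟩ := GradedSimple.exists_expGroup_apply_eq_sum hD hk.ne' hab hmax hlong
    he S subset_rfl hξ'
  obtain ⟨g₂, hg₂, hgc⟩ := GradedSimple.exists_expGroup_normalize (b := b) (D := D) hmax.1.2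
    (fun β hβ => (he β hβ).1) c
  refine ⟨g₂ * g₁, mul_mem hg₂ hg₁, fun β => if c β = 0 then 0 else 1, fun β => ?_, ?_⟩
  · dsimp only
    split_ifs <;> simp
  · rw [Units.val_mul, Module.End.mul_apply, hc, hgc]
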